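/- Let $n$ agents and an opinion alphabet $[M]=\{1,\dots,M\}$ be given, and work on a probability space $(\Omega,\mathbb{P})$. Agent $i$ holds an opinion $X_i\in[M]$ (possibly random); $\mathbf{e}_m\in\mathbb{R}^M$ is the $m$-th unit row vector and $\Pi=\frac1n\sum_{i=1}^n \mathbf{e}_{X_i}$ is the empirical histogram. For $t=0,1,2,\dots$ let $\mathcal{G}(t)$ be a (possibly random) undirected simple graph on $[n]$ with neighbourhoods $\mathcal{N}_i(t)$; let $W(t)$ be a random $n\times n$ matrix with nonnegative entries and $W_{ij}(t)=0$ unless $i,j$ are adjacent in $\mathcal{G}(t)$; let $A(t),B(t)$ be random diagonal $n\times n$ matrices; and let $\delta(t)$ be deterministic step sizes. The estimates are the rows $Q_i(t)$ of the $n\times M$ matrix $\mathbf{Q}(t)$, with $Q_i(0)=\mathbf{e}_{X_i}$ and $$\mathbf{Q}(t+1)=(I-\delta(t)A(t))\mathbf{Q}(t)-\delta(t)B(t)\mathbf{Y}(t)+\delta(t)W(t)\mathbf{Y}(t).$$ Here the rows $Y_i(t)$ of $\mathbf{Y}(t)$ (the messages) lie in $\{\mathbf{0},\mathbf{e}_1,\dots,\mathbf{e}_M\}$.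 Let $\mathcal{F}_t$ be the $\sigma$-algebra generated by $\mathbf{Q}(s)$, $s\le t$, and $\mathcal{G}(s)$, $s<t$. The messages satisfy $\mathbb{P}(Y_i(t)=\mathbf{e}_m\mid\mathcal{F}_t)=P_{i,m}(t)$, where the $i$-th row $P_i(t)$ of $\mathbf{P}(t)$ is a measurable function (which may depend on $i$ and $t$) of $Q_i(t)$. Write $\bar A(t)=\mathbb{E}[A(t)\mid\mathcal{F}_t]$, $\bar B(t)=\mathbb{E}[B(t)\mid\mathcal{F}_t]$, $\bar W(t)=\mathbb{E}[W(t)\mid\mathcal{F}_t]$, $\bar H(t)=\bar W(t)-\bar B(t)-\bar A(t)$ and $$\mathbf{C}(t)=(W(t)-B(t))(\mathbf{P}(t)-\mathbf{Q}(t))+(W(t)-B(t)-\bar W(t)+\bar B(t))\mathbf{Y}(t).$$ Suppose that the entries of $W(t),A(t),B(t)$ are bounded in absolute value, almost surely, by a constant that does not depend on $t$, and that the following conditions hold. 1. (Mixing coefficients) Almost surely $\sum_{j\in\mathcal{N}_i(t)}W_{ij}(t)-A_{ii}(t)-B_{ii}(t)=0$ for all $t>0$ and all $i$. 2. (Decreasing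 step size) $\delta(t)\ge0$, $\delta(t)\to0$, $\sum_{t\ge1}\delta(t)=\infty$ and $\sum_{t\ge1}\delta(t)^2<\infty$. 3. (Limiting dynamics) There is a fixed symmetric matrix $\bar H$ such that almost surely $\bar H_{ij}(t)-\bar H_{ij}=O(\delta(t))$ as $t\to\infty$ for all $i,j$; every eigenvalue $\lambda$ of $\bar H$ satisfies $|\lambda|<1$; $\bar H\mathbf{1}=\mathbf{0}$; and the kernel of $\bar H$ is spanned by $\mathbf{1}$. 4. (Bounded perturbation) Almost surely $\|\mathbb{E}[\mathbf{C}(t)\mid\mathcal{F}_t]\|=O(\delta(t))$ as $t\to\infty$ (Frobenius norm). 5. (Mean preservation) Almost surely $\frac1n\mathbf{1}^{\top}\mathbf{Q}(t)=\Pi$ for all $t$. Then $\mathbf{Q}(t)\to\mathbf{1}\Pi$ almost surely, that is, almost surely $Q_i(t)\to\Pi$ for every agent $i$. -/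

import Mathlib

open MeasureTheory Filter Asymptotics
open scoped Topology Matrix

noncomputable section

/-- The message alphabet `{0, e₁, …, e_M}`; the message `0` means that the node stays silent. -/
def messageSet (M : ℕ) : Set (Fin M → ℝ) :=
  {0} ∪ Set.range (fun m : Fin M => (Pi.single m 1 : Fin M → ℝ))

/-- The `σ`-algebra of the history at time `t`: it is generated by the estimates `Q(s)`, `s ≤ t`,
and by the communication graphs `G(s)`, `s < t`. -/
@[reducible] def historySigma {Ω : Type*} {n M : ℕ} (Q : ℕ → Ω → Matrix (Fin n) (Fin M) ℝ)
    (G : ℕ → Ω → SimpleGraph (Fin n)) (t : ℕ) : MeasurableSpace Ω :=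
  (⨆ s : ℕ, ⨆ _ : s ≤ t, ⨆ i : Fin n, ⨆ m : Fin M,
      MeasurableSpace.comap (fun ω => Q s ω i m) (borel ℝ)) ⊔
    MeasurableSpace.generateFrom
      {E | ∃ s < t, ∃ i j : Fin n, E = {ω | (G s ω).Adj i j}}

/-- The entrywise conditional expectation of a random matrix. -/
def condExpMatrix {Ω : Type*} [MeasurableSpace Ω] {k l : ℕ} (μ : Measure Ω)
    (F : MeasurableSpace Ω) (Z : Ω → Matrix (Fin k) (Fin l) ℝ) :
    Ω → Matrix (Fin k) (Fin l) ℝ :=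
  fun ω => Matrix.of fun i j => (μ[fun ω' => Z ω' i j | F]) ω

/-- The Frobenius norm. -/
def frobeniusNorm {k l : ℕ} (Z : Matrix (Fin k) (Fin l) ℝ) : ℝ :=
  Real.sqrt (∑ i, ∑ j, Z i j ^ 2)

/-- A social sampling protocol with linear updates: `n` agents, opinions in `Fin M`, on a
probability space `(Ω, μ)`. The matrices `A(t)` and `B(t)` of the protocol are diagonal and are
given by their diagonals `a t ω` and `b t ω`. -/
structure SocialSampling (n M : ℕ) {Ω : Type*} [MeasurableSpace Ω] (μ : Measure Ω) where
  /-- initial opinions -/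
  X : Fin n → Ω → Fin M
  /-- communication graphs (undirected, possibly random) -/
  G : ℕ → Ω → SimpleGraph (Fin n)
  /-- step sizes -/
  δ : ℕ → ℝ
  /-- weights given to the messages of the neighbours -/
  W : ℕ → Ω → Matrix (Fin n) (Fin n) ℝ
  /-- diagonal of `A(t)` -/
  a : ℕ → Ω → Fin n → ℝ
  /-- diagonal of `B(t)` -/
  b : ℕ → Ω → Fin n → ℝ
  /-- the rule by which node `i` at time `t` turns its estimate into a sampling distribution -/
  rule : ℕ → Fin n → (Fin M → ℝ) → (Fin M → ℝ)
  /-- messages; row `i` is the message of node `i` -/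
  Y : ℕ → Ω → Matrix (Fin n) (Fin M) ℝ
  /-- estimates; row `i` is the estimate of node `i` -/
  Q : ℕ → Ω → Matrix (Fin n) (Fin M) ℝ
  measurable_X : ∀ i, Measurable (X i)
  measurableSet_G : ∀ t i j, MeasurableSet {ω | (G t ω).Adj i j}
  measurable_W : ∀ t i j, Measurable fun ω => W t ω i j
  measurable_a : ∀ t i, Measurable fun ω => a t ω i
  measurable_b : ∀ t i, Measurable fun ω => b t ω i
  measurable_rule : ∀ t i, Measurable (rule t i)
  measurable_Y : ∀ t i m, Measurable fun ω => Y t ω i m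
  W_nonneg : ∀ t ω i j, 0 ≤ W t ω i j
  W_support : ∀ t ω i j, ¬ (G t ω).Adj i j → W t ω i j = 0
  Y_mem : ∀ t ω i, Y t ω i ∈ messageSet M
  /-- Given the history, node `i` sends `e_m` with probability `P_{i,m}(t)`, where
  `P_i(t) = rule t i (Q_i(t))`; with the remaining probability it is silent. (In particular
  `P_i(t)` is almost surely nonnegative with sum at most one.) -/
  sampling : ∀ t i m,
    μ[Set.indicator {ω | Y t ω i = Pi.single m 1} (fun _ => (1 : ℝ)) | historySigma Q G t]
      =ᵐ[μ] fun ω => rule t i (Q t ω i) m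
  init : ∀ ω i, Q 0 ω i = Pi.single (X i ω) 1
  update : ∀ t ω, Q (t + 1) ω =
    (1 - δ t • Matrix.diagonal (a t ω)) * Q t ω
      - δ t • (Matrix.diagonal (b t ω) * Y t ω) + δ t • (W t ω * Y t ω)

namespace SocialSampling

variable {n M : ℕ} {Ω : Type*} [MeasurableSpace Ω] {μ : Measure Ω}

/-- The empirical distribution of the initial opinions. -/
def empirical (S : SocialSampling n M μ) (ω : Ω) : Fin M → ℝ :=
  fun m => (1 / (n : ℝ)) * ∑ i, if S.X i ω = m then 1 else 0

/-- `F_t`. -/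
@[reducible] def F (S : SocialSampling n M μ) (t : ℕ) : MeasurableSpace Ω := historySigma S.Q S.G t

/-- `A(t)`. -/
def A (S : SocialSampling n M μ) (t : ℕ) (ω : Ω) : Matrix (Fin n) (Fin n) ℝ :=
  Matrix.diagonal (S.a t ω)

/-- `B(t)`. -/
def B (S : SocialSampling n M μ) (t : ℕ) (ω : Ω) : Matrix (Fin n) (Fin n) ℝ :=
  Matrix.diagonal (S.b t ω)

/-- `P(t)`: row `i` is the sampling distribution of node `i` on `e_1, …, e_M`. -/
def P (S : SocialSampling n M μ) (t : ℕ) (ω : Ω) : Matrix (Fin n) (Fin M) ℝ :=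
  Matrix.of fun i => S.rule t i (S.Q t ω i)

/-- `Ā(t) = E[A(t) | F_t]`. -/
def Abar (S : SocialSampling n M μ) (t : ℕ) : Ω → Matrix (Fin n) (Fin n) ℝ :=
  condExpMatrix μ (S.F t) (S.A t)

/-- `B̄(t) = E[B(t) | F_t]`. -/
def Bbar (S : SocialSampling n M μ) (t : ℕ) : Ω → Matrix (Fin n) (Fin n) ℝ :=
  condExpMatrix μ (S.F t) (S.B t)

/-- `W̄(t) = E[W(t) | F_t]`. -/
def Wbar (S : SocialSampling n M μ) (t : ℕ) : Ω → Matrix (Fin n) (Fin n) ℝ :=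
  condExpMatrix μ (S.F t) (S.W t)

/-- `H̄(t) = W̄(t) - B̄(t) - Ā(t)`. -/
def Hbar (S : SocialSampling n M μ) (t : ℕ) (ω : Ω) : Matrix (Fin n) (Fin n) ℝ :=
  S.Wbar t ω - S.Bbar t ω - S.Abar t ω

/-- The correction term `C(t)`. -/
def C (S : SocialSampling n M μ) (t : ℕ) (ω : Ω) : Matrix (Fin n) (Fin M) ℝ :=
  (S.W t ω - S.B t ω) * (S.P t ω - S.Q t ω)
    + (S.W t ω - S.B t ω - S.Wbar t ω + S.Bbar t ω) * S.Y t ω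

/-- The coefficients `W(t)`, `A(t)`, `B(t)` are uniformly bounded. -/
def BoundedCoefficients (S : SocialSampling n M μ) : Prop :=
  ∃ K : ℝ, ∀ t, ∀ᵐ ω ∂μ,
    (∀ i j, |S.W t ω i j| ≤ K) ∧ ∀ i, |S.a t ω i| ≤ K ∧ |S.b t ω i| ≤ K

open Classical in
/-- Mixing coefficients: `∑_{j ∈ N_i(t)} W_ij(t) - A_ii(t) - B_ii(t) = 0` for `t > 0`. -/
def MixingCoefficients (S : SocialSampling n M μ) : Prop :=
  ∀ t, 0 < t → ∀ᵐ ω ∂μ, ∀ i,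
    (∑ j with (S.G t ω).Adj i j, S.W t ω i j) - S.A t ω i i - S.B t ω i i = 0

/-- Decreasing step size. -/
def DecreasingStepSize (S : SocialSampling n M μ) : Prop :=
  (∀ t, 0 ≤ S.δ t) ∧ Tendsto S.δ atTop (𝓝 0) ∧
    Tendsto (fun T => ∑ t ∈ Finset.Icc 1 T, S.δ t) atTop atTop ∧
    Summable fun t => S.δ (t + 1) ^ 2

/-- Limiting dynamics: `H̄(t) = H + O(δ(t))` almost surely, for a fixed symmetric matrix `H` all
of whose eigenvalues have modulus less than `1`, with `H 1 = 0` and with no null vectors other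
than the multiples of `1`. -/
def LimitingDynamics (S : SocialSampling n M μ) : Prop :=
  ∃ H : Matrix (Fin n) (Fin n) ℝ, H.IsSymm ∧
    (∀ i j, ∀ᵐ ω ∂μ, (fun t => S.Hbar t ω i j - H i j) =O[atTop] S.δ) ∧
    (∀ r : ℝ, Module.End.HasEigenvalue (Matrix.toLin' H) r → |r| < 1) ∧
    H *ᵥ (fun _ => 1) = 0 ∧
    ∀ v : Fin n → ℝ, H *ᵥ v = 0 → ∃ c : ℝ, v = fun _ => c

/-- Bounded perturbation: `‖E[C(t) | F_t]‖ = O(δ(t))` almost surely. -/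
def BoundedPerturbation (S : SocialSampling n M μ) : Prop :=
  ∀ᵐ ω ∂μ, (fun t => frobeniusNorm (condExpMatrix μ (S.F t) (S.C t) ω)) =O[atTop] S.δ

/-- Mean preservation: the average of the node estimates is the empirical distribution. -/
def MeanPreservation (S : SocialSampling n M μ) : Prop :=
  ∀ t, ∀ᵐ ω ∂μ, ∀ m, (1 / (n : ℝ)) * ∑ i, S.Q t ω i m = S.empirical ω m

end SocialSampling

end

/-! The proof is a Lyapunov argument for stochastic approximation. Write `Q(t+1) = Q(t) + δ(t) D(t)`
and let `V(t)` be the squared Frobenius norm of `Q(t)` with its column means removed. Given the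
history, `D(t)` has mean `H̄(t) Q(t) + E[C(t) | F_t]` (`condExp_increment`), a perturbation of size
`O(δ(t))` of `H Q(t)`, and its square grows at most linearly in `‖Q(t)‖²`.

Off the diagonal `H` is a limit of conditional means of nonnegative weights. Thus `-H` is a weighted
graph Laplacian whose kernel is the constants, and `H` is negative definite on mean-zero vectors
(`exists_quadratic_form_le_of_offDiag_nonneg`), with some constant `r > 0`. Mean preservation keeps
the column means bounded, so `‖Q(t)‖²` is controlled by `V(t)`, and
`condExp_sqNorm_centered_succ_le` gives `E[V(t+1) | F_t] ≤ (1 + α(t)) V(t) + β(t) - 2 r δ(t) V(t)`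
with `α(t), β(t) = O(δ(t)²)` almost surely, hence summable.

By `robbins_siegmund`, `V(t)` converges and `∑ δ(t) V(t) < ∞`. Since `∑ δ(t) = ∞`, the limit is
zero, and mean preservation identifies the common limit of the rows. -/

/-! ### Almost supermartingales. -/

/-- A supermartingale that is bounded below converges almost surely. -/
theorem MeasureTheory.Supermartingale.exists_ae_tendsto_of_bddBelow {Ω : Type*}
    {m0 : MeasurableSpace Ω} {μ : Measure Ω} [IsFiniteMeasure μ] {ℱ : Filtration ℕ m0}
    {U : ℕ → Ω → ℝ} (hU : Supermartingale U ℱ μ) (a : ℝ) (ha : ∀ t, ∀ᵐ ω ∂μ, -a ≤ U t ω) :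
    ∀ᵐ ω ∂μ, ∃ c, Tendsto (fun t => U t ω) atTop (𝓝 c) := by
  have hbdd : ∀ t, eLpNorm ((-U) t) 1 μ ≤
      ((∫ ω, U 0 ω ∂μ + 2 * |a| * μ.real Set.univ).toNNReal : ENNReal) := by
    intro t
    have hint := hU.integrable t
    rw [Pi.neg_apply, eLpNorm_neg, eLpNorm_one_eq_lintegral_enorm,
      ← ofReal_integral_norm_eq_lintegral_enorm hint]
    refine ENNReal.ofReal_le_ofReal ?_
    -- Where `U ≥ -a`, one has `|U| ≤ U + 2|a|`; as `E U_t ≤ E U_0`, this bounds `U` in `L¹`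
    -- uniformly in `t`.
    have h1 : ∫ ω, ‖U t ω‖ ∂μ ≤ ∫ ω, (U t ω + 2 * |a|) ∂μ := by
      refine integral_mono_ae hint.norm (hint.add (integrable_const _)) ?_
      filter_upwards [ha t] with ω hω
      have := le_abs_self a
      rw [Real.norm_eq_abs]
      refine abs_le.2 ⟨by linarith, by linarith [abs_nonneg a]⟩
    have h2 : ∫ ω, U t ω ∂μ ≤ ∫ ω, U 0 ω ∂μ := by
      have := hU.setIntegral_le (Nat.zero_le t) (MeasurableSet.univ (α := Ω))
      simpa using this
    rw [integral_add hint (integrable_const _), integral_const, smul_eq_mul] at h1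
    linarith
  filter_upwards [hU.neg.exists_ae_tendsto_of_bdd hbdd] with ω ⟨c, hc⟩
  exact ⟨-c, by simpa using hc.neg⟩

/-- A bounded real function times an integrable function is integrable. -/
theorem integrable_mul_of_abs_le_one {Ω : Type*} {m0 : MeasurableSpace Ω} {μ : Measure Ω}
    {f g : Ω → ℝ} (hf : Integrable f μ) (hg : AEStronglyMeasurable g μ)
    (hb : ∀ ω, |g ω| ≤ 1) : Integrable (fun ω => g ω * f ω) μ :=
  hf.bdd_mul hg (ae_of_all _ hb)

/-- Almost supermartingales, without multiplicative perturbation. -/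
theorem ae_tendsto_and_summable_of_condExp_le_add_sub {Ω : Type*} {m0 : MeasurableSpace Ω}
    {μ : Measure Ω} [IsFiniteMeasure μ] {ℱ : Filtration ℕ m0} {V β γ : ℕ → Ω → ℝ}
    (hV : StronglyAdapted ℱ V) (hβ : StronglyAdapted ℱ β) (hγ : StronglyAdapted ℱ γ)
    (hVi : ∀ t, Integrable (V t) μ) (hβi : ∀ t, Integrable (β t) μ)
    (hγi : ∀ t, Integrable (γ t) μ) (hV0 : ∀ t ω, 0 ≤ V t ω) (hβ0 : ∀ t ω, 0 ≤ β t ω)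
    (hγ0 : ∀ t ω, 0 ≤ γ t ω)
    (h : ∀ t, ∀ᵐ ω ∂μ, (μ[V (t + 1) | ℱ t]) ω ≤ V t ω + β t ω - γ t ω) :
    ∀ᵐ ω ∂μ, Summable (fun t => β t ω) →
      (∃ l, Tendsto (fun t => V t ω) atTop (𝓝 l)) ∧ Summable fun t => γ t ω := by
  classical
  let S : ℕ → Ω → ℝ := fun t ω => ∑ s ∈ Finset.range (t + 1), β s ω
  have hSmono : ∀ ω s t, s ≤ t → S s ω ≤ S t ω := fun ω s t hst =>
    Finset.sum_le_sum_of_subset_of_nonneg (by gcongr) (fun i _ _ => hβ0 i ω)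
  have hSm : StronglyAdapted ℱ S := fun t => by
    refine Finset.stronglyMeasurable_fun_sum _ fun s hs => ?_
    exact (hβ s).mono (ℱ.mono (Nat.lt_succ_iff.1 (Finset.mem_range.1 hs)))
  -- Localization: `χ a` switches off for good once the partial sums of `β` exceed `a`. Since `S t`
  -- includes the term `t`, it is still `F_t`-measurable.
  let χ : ℕ → ℕ → Ω → ℝ := fun a t ω => if S t ω ≤ a then 1 else 0
  have hχ0 : ∀ a t ω, 0 ≤ χ a t ω := fun a t ω => by
    simp only [χ]; split_ifs <;> norm_num
  have hχ1 : ∀ a t ω, χ a t ω ≤ 1 := fun a t ω => by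
    simp only [χ]; split_ifs <;> norm_num
  have hχabs : ∀ a t ω, |χ a t ω| ≤ 1 := fun a t ω => by
    rw [abs_of_nonneg (hχ0 a t ω)]; exact hχ1 a t ω
  have hχanti : ∀ a t ω, χ a (t + 1) ω ≤ χ a t ω := fun a t ω => by
    simp only [χ]
    have := hSmono ω t (t + 1) (by omega)
    split_ifs <;> linarith
  have hχm : ∀ a, StronglyAdapted ℱ (χ a) := fun a t => by
    refine StronglyMeasurable.ite ?_ stronglyMeasurable_const stronglyMeasurable_const
    exact (hSm t).measurable measurableSet_Iic
  have hχm' : ∀ a t, AEStronglyMeasurable (χ a t) μ := fun a t =>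
    ((hχm a t).mono (ℱ.le t)).aestronglyMeasurable
  -- The weight of `V t` is taken one step earlier, so that it can be pulled out of the conditional
  -- expectation given `ℱ (t - 1)`; at `t = 0` there is no earlier index. For the same reason `D a
  -- (t + 1)` is `ℱ t`-measurable.
  let Vt : ℕ → ℕ → Ω → ℝ := fun a t ω => (if t = 0 then 1 else χ a (t - 1) ω) * V t ω
  let D : ℕ → ℕ → Ω → ℝ := fun a t ω =>
    ∑ s ∈ Finset.range t, (χ a s ω * γ s ω - χ a s ω * β s ω)
  have hVtm : ∀ a, StronglyAdapted ℱ (Vt a) := fun a t => by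
    refine StronglyMeasurable.mul ?_ (hV t)
    rcases t with _ | t
    · simpa using stronglyMeasurable_const
    · simpa using (hχm a t).mono (ℱ.mono (Nat.le_succ t))
  have hDm : ∀ a t u, t ≤ u + 1 → StronglyMeasurable[ℱ u] (D a t) := fun a t u htu => by
    refine Finset.stronglyMeasurable_fun_sum _ fun s hs => ?_
    have hs' : s ≤ u := by have := Finset.mem_range.1 hs; omega
    exact ((((hχm a s).mul (hγ s)).sub ((hχm a s).mul (hβ s)))).mono (ℱ.mono hs')
  have hVti : ∀ a t, Integrable (Vt a t) μ := fun a t => by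
    rcases t with _ | t
    · simpa [Vt] using hVi 0
    · simpa [Vt] using integrable_mul_of_abs_le_one (hVi (t + 1)) (hχm' a t) (hχabs a t)
  have hDi : ∀ a t, Integrable (D a t) μ := fun a t => by
    refine integrable_finsetSum _ fun s _ => ?_
    exact (integrable_mul_of_abs_le_one (hγi s) (hχm' a s) (hχabs a s)).sub
      (integrable_mul_of_abs_le_one (hβi s) (hχm' a s) (hχabs a s))
  have hχβ : ∀ a t ω, ∑ s ∈ Finset.range t, χ a s ω * β s ω ≤ a := by
    intro a t ω
    induction t with
    | zero => simp
    | succ t ih =>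
      -- If the switch is still on, the whole sum is at most `S t`; otherwise the new term vanishes.
      by_cases hc : S t ω ≤ a
      · refine le_trans (Finset.sum_le_sum fun s _ => ?_) hc
        exact mul_le_of_le_one_left (hβ0 s ω) (hχ1 a s ω)
      · rw [Finset.sum_range_succ]
        have : χ a t ω = 0 := if_neg hc
        rw [this]; simpa using ih
  have hχγ : ∀ a t ω, 0 ≤ χ a t ω * γ t ω := fun a t ω => mul_nonneg (hχ0 a t ω) (hγ0 t ω)
  have hVt0 : ∀ a t ω, 0 ≤ Vt a t ω := fun a t ω => by
    refine mul_nonneg ?_ (hV0 t ω)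
    split_ifs
    · exact zero_le_one
    · exact hχ0 _ _ _
  have hsuper : ∀ a : ℕ, Supermartingale (fun t ω => Vt a t ω + D a t ω) ℱ μ := by
    intro a
    refine supermartingale_nat (fun t => (hVtm a t).add (hDm a t t (by omega)))
      (fun t => (hVti a t).add (hDi a t)) fun t => ?_
    have e1 : μ[fun ω => Vt a (t + 1) ω + D a (t + 1) ω | ℱ t] =ᵐ[μ]
        μ[Vt a (t + 1) | ℱ t] + μ[D a (t + 1) | ℱ t] :=
      condExp_add (hVti a (t + 1)) (hDi a (t + 1)) _
    have e2 : μ[D a (t + 1) | ℱ t] = D a (t + 1) :=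
      condExp_of_stronglyMeasurable (ℱ.le t) (hDm a (t + 1) t le_rfl) (hDi a (t + 1))
    have e3 : μ[Vt a (t + 1) | ℱ t] =ᵐ[μ] χ a t * μ[V (t + 1) | ℱ t] := by
      have : Vt a (t + 1) = χ a t * V (t + 1) := by ext ω; simp [Vt]
      rw [this]
      refine condExp_mul_of_stronglyMeasurable_left (hχm a t) ?_ (hVi (t + 1))
      rw [← this]; exact hVti a (t + 1)
    filter_upwards [e1, e3, h t] with ω h1 h3 h4
    rw [h1, Pi.add_apply, h3, e2, Pi.mul_apply]
    have h5 : χ a t ω * V t ω ≤ Vt a t ω := by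
      refine mul_le_mul_of_nonneg_right ?_ (hV0 t ω)
      rcases t with _ | t
      · simpa using hχ1 a 0 ω
      · simpa using hχanti a t ω
    have h6 := mul_le_mul_of_nonneg_left h4 (hχ0 a t ω)
    have h7 : D a (t + 1) ω = D a t ω + (χ a t ω * γ t ω - χ a t ω * β t ω) :=
      Finset.sum_range_succ _ _
    rw [h7]
    linarith
  have hconv := fun a : ℕ => (hsuper a).exists_ae_tendsto_of_bddBelow a fun t => ae_of_all _ fun ω => by
    have h1 := hχβ a t ω
    have h2 : 0 ≤ ∑ s ∈ Finset.range t, χ a s ω * γ s ω := Finset.sum_nonneg fun s _ => hχγ a s ω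
    have h3 : D a t ω = ∑ s ∈ Finset.range t, χ a s ω * γ s ω
        - ∑ s ∈ Finset.range t, χ a s ω * β s ω := Finset.sum_sub_distrib _ _
    rw [h3]
    linarith [hVt0 a t ω]
  filter_upwards [ae_all_iff.2 hconv] with ω hω hsum
  -- With `a` above the total sum of `β`, the truncation never acts at this `ω`.
  obtain ⟨a, ha⟩ := exists_nat_ge (∑' t, β t ω)
  have hχ : ∀ t, χ a t ω = 1 := fun t =>
    if_pos ((hsum.sum_le_tsum _ (fun s _ => hβ0 s ω)).trans ha)
  obtain ⟨c, hc⟩ := hω a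
  have hB := hsum.hasSum.tendsto_sum_nat
  have hVG : Tendsto (fun t => V t ω + ∑ s ∈ Finset.range t, γ s ω) atTop
      (𝓝 (c + ∑' t, β t ω)) := by
    refine (hc.add hB).congr fun t => ?_
    simp only [Vt, D, hχ, Finset.sum_sub_distrib, one_mul, ite_self]
    ring
  have hγs : Summable fun t => γ t ω := by
    obtain ⟨R, hR⟩ := hVG.bddAbove_range
    refine summable_of_sum_range_le (c := R) (fun t => hγ0 t ω) fun t => ?_
    have := hR ⟨t, rfl⟩
    simp only at this
    linarith [hV0 t ω]
  refine ⟨⟨_, (hVG.sub hγs.hasSum.tendsto_sum_nat).congr fun t => ?_⟩, hγs⟩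
  simp

/-- The Robbins–Siegmund theorem on almost supermartingales. -/
theorem robbins_siegmund {Ω : Type*} {m0 : MeasurableSpace Ω}
    {μ : Measure Ω} [IsFiniteMeasure μ] {ℱ : Filtration ℕ m0} {V α β γ : ℕ → Ω → ℝ}
    (hV : StronglyAdapted ℱ V) (hα : StronglyAdapted ℱ α) (hβ : StronglyAdapted ℱ β)
    (hγ : StronglyAdapted ℱ γ)
    (hVi : ∀ t, Integrable (V t) μ) (hβi : ∀ t, Integrable (β t) μ)
    (hγi : ∀ t, Integrable (γ t) μ) (hV0 : ∀ t ω, 0 ≤ V t ω) (hα0 : ∀ t ω, 0 ≤ α t ω)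
    (hβ0 : ∀ t ω, 0 ≤ β t ω) (hγ0 : ∀ t ω, 0 ≤ γ t ω)
    (h : ∀ t, ∀ᵐ ω ∂μ, (μ[V (t + 1) | ℱ t]) ω ≤ (1 + α t ω) * V t ω + β t ω - γ t ω) :
    ∀ᵐ ω ∂μ, Summable (fun t => α t ω) → Summable (fun t => β t ω) →
      (∃ l, Tendsto (fun t => V t ω) atTop (𝓝 l)) ∧ Summable fun t => γ t ω := by
  -- Dividing `V` by `p` absorbs the factor `1 + α`. The product defining `p (t + 1)` stops at `s =
  -- t`, so it is `ℱ t`-measurable.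
  let p : ℕ → Ω → ℝ := fun t ω => ∏ s ∈ Finset.range t, (1 + α s ω)
  have hp1 : ∀ t ω, 1 ≤ p t ω := fun t ω =>
    Finset.prod_induction _ (fun x => 1 ≤ x) (fun _ _ => one_le_mul_of_one_le_of_one_le) le_rfl
      fun s _ => by linarith [hα0 s ω]
  have hp0 : ∀ t ω, 0 < p t ω := fun t ω => zero_lt_one.trans_le (hp1 t ω)
  have hpm : ∀ t u, t ≤ u + 1 → StronglyMeasurable[ℱ u] (p t) := fun t u htu => by
    refine Finset.stronglyMeasurable_fun_prod _ fun s hs => ?_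
    have hs' : s ≤ u := by have := Finset.mem_range.1 hs; omega
    exact stronglyMeasurable_const.add ((hα s).mono (ℱ.mono hs'))
  let q : ℕ → Ω → ℝ := fun t ω => (p t ω)⁻¹
  have hq0 : ∀ t ω, 0 < q t ω := fun t ω => inv_pos.2 (hp0 t ω)
  have hqm : ∀ t u, t ≤ u + 1 → StronglyMeasurable[ℱ u] (q t) := fun t u htu =>
    (hpm t u htu).measurable.inv.stronglyMeasurable
  have hqm' : ∀ t, AEStronglyMeasurable (q t) μ := fun t =>
    ((hqm t t (by omega)).mono (ℱ.le t)).aestronglyMeasurable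
  have hq1 : ∀ t ω, |q t ω| ≤ 1 := fun t ω => by
    rw [abs_of_pos (hq0 t ω)]; exact inv_le_one_of_one_le₀ (hp1 t ω)
  have key := ae_tendsto_and_summable_of_condExp_le_add_sub (μ := μ) (ℱ := ℱ)
    (V := fun t ω => q t ω * V t ω) (β := fun t ω => q (t + 1) ω * β t ω)
    (γ := fun t ω => q (t + 1) ω * γ t ω)
    (fun t => (hqm t t (by omega)).mul (hV t)) (fun t => (hqm (t + 1) t le_rfl).mul (hβ t))
    (fun t => (hqm (t + 1) t le_rfl).mul (hγ t))
    (fun t => integrable_mul_of_abs_le_one (hVi t) (hqm' t) (hq1 t))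
    (fun t => integrable_mul_of_abs_le_one (hβi t) (hqm' (t + 1)) (hq1 (t + 1)))
    (fun t => integrable_mul_of_abs_le_one (hγi t) (hqm' (t + 1)) (hq1 (t + 1)))
    (fun t ω => mul_nonneg (hq0 t ω).le (hV0 t ω))
    (fun t ω => mul_nonneg (hq0 (t + 1) ω).le (hβ0 t ω))
    (fun t ω => mul_nonneg (hq0 (t + 1) ω).le (hγ0 t ω)) (fun t => by
      have e : μ[fun ω => q (t + 1) ω * V (t + 1) ω | ℱ t] =ᵐ[μ]
          q (t + 1) * μ[V (t + 1) | ℱ t] :=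
        condExp_mul_of_stronglyMeasurable_left (hqm (t + 1) t le_rfl)
          (integrable_mul_of_abs_le_one (hVi (t + 1)) (hqm' (t + 1)) (hq1 (t + 1))) (hVi (t + 1))
      filter_upwards [e, h t] with ω h1 h2
      rw [h1, Pi.mul_apply]
      have h3 := mul_le_mul_of_nonneg_left h2 (hq0 (t + 1) ω).le
      have h4 : q (t + 1) ω * (1 + α t ω) = q t ω := by
        have : p (t + 1) ω = p t ω * (1 + α t ω) := Finset.prod_range_succ _ _
        have h5 : 1 + α t ω ≠ 0 := by linarith [hα0 t ω]
        simp only [q, this, mul_inv, mul_assoc, inv_mul_cancel₀ h5, mul_one]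
      rw [← h4]
      linarith)
  filter_upwards [key] with ω hω hαs hβs
  have hβs' : Summable fun t => q (t + 1) ω * β t ω :=
    Summable.of_nonneg_of_le (fun t => mul_nonneg (hq0 (t + 1) ω).le (hβ0 t ω))
      (fun t => mul_le_of_le_one_left (hβ0 t ω) ((le_abs_self _).trans (hq1 _ ω))) hβs
  obtain ⟨⟨l, hl⟩, hγs⟩ := hω hβs'
  -- Summability of `α` makes the products converge, so multiplying back by `p` preserves
  -- convergence, and their boundedness preserves summability.
  have hp : Tendsto (fun t => p t ω) atTop (𝓝 (∏' t, (1 + α t ω))) :=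
    (Real.multipliable_one_add_of_summable hαs).hasProd.tendsto_prod_nat
  refine ⟨⟨_, (hp.mul hl).congr fun t => ?_⟩, ?_⟩
  · simp only [q]
    rw [← mul_assoc, mul_inv_cancel₀ (hp0 t ω).ne', one_mul]
  · obtain ⟨R, hR⟩ := hp.bddAbove_range
    refine Summable.of_nonneg_of_le (fun t => hγ0 t ω) (fun t => ?_) (hγs.mul_left R)
    have h1 : p (t + 1) ω ≤ R := hR ⟨t + 1, rfl⟩
    have h2 : γ t ω = p (t + 1) ω * (q (t + 1) ω * γ t ω) := by
      simp only [q]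
      rw [← mul_assoc, mul_inv_cancel₀ (hp0 _ ω).ne', one_mul]
    calc γ t ω = p (t + 1) ω * (q (t + 1) ω * γ t ω) := h2
      _ ≤ _ := mul_le_mul_of_nonneg_right h1 (mul_nonneg (hq0 (t + 1) ω).le (hγ0 t ω))

/-- If `v` converges, `∑ δ = ∞` and `∑ δ v < ∞`, with nonnegative terms, then `v` tends to `0`. -/
theorem tendsto_zero_of_summable_mul {δ v : ℕ → ℝ} (hδ : ∀ t, 0 ≤ δ t) (hv : ∀ t, 0 ≤ v t)
    (hdiv : ¬ Summable δ) (hsum : Summable fun t => δ t * v t) {l : ℝ}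
    (hl : Tendsto v atTop (𝓝 l)) : Tendsto v atTop (𝓝 0) := by
  have hl0 : 0 ≤ l := ge_of_tendsto' hl hv
  rcases hl0.eq_or_lt with rfl | hpos
  · exact hl
  -- A limit `l > 0` would give `δ ≤ (2 / l) δ v` eventually, and `δ` would be summable.
  · refine absurd ?_ hdiv
    refine summable_of_isBigO_nat hsum (IsBigO.of_bound (2 / l) ?_)
    filter_upwards [hl.eventually (lt_mem_nhds (half_lt_self hpos))] with t ht
    rw [Real.norm_of_nonneg (hδ t), Real.norm_of_nonneg (mul_nonneg (hδ t) (hv t))]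
    calc δ t = 2 / l * (δ t * (l / 2)) := by field_simp
      _ ≤ _ := by
        have := hδ t
        gcongr

/-! ### Negative definiteness of the limiting dynamics. -/

/-- A symmetric matrix with nonnegative off-diagonal entries and vanishing row sums, whose kernel
consists of constant vectors, is negative definite on mean-zero vectors. -/
theorem exists_quadratic_form_le_of_offDiag_nonneg {n : ℕ} {H : Matrix (Fin n) (Fin n) ℝ}
    (hsymm : H.IsSymm) (hoff : ∀ i j, i ≠ j → 0 ≤ H i j) (hone : H *ᵥ (fun _ => 1) = 0)
    (hker : ∀ v : Fin n → ℝ, H *ᵥ v = 0 → ∃ c : ℝ, v = fun _ => c) :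
    ∃ r > 0, ∀ z : Fin n → ℝ, ∑ i, z i = 0 →
      ∑ i, ∑ j, z i * H i j * z j ≤ -r * ∑ i, z i ^ 2 := by
  have hrow : ∀ i, ∑ j, H i j = 0 := fun i => by
    simpa [Matrix.mulVec, dotProduct] using congrFun hone i
  -- The Dirichlet form of the weighted graph: the square terms drop out because rows and, by
  -- symmetry, columns sum to zero.
  have hform : ∀ z : Fin n → ℝ,
      ∑ i, ∑ j, H i j * (z i - z j) ^ 2 = -2 * ∑ i, ∑ j, z i * H i j * z j := by
    intro z
    have e1 : ∑ i, ∑ j, H i j * z i ^ 2 = 0 :=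
      Finset.sum_eq_zero fun i _ => by rw [← Finset.sum_mul, hrow, zero_mul]
    have e2 : ∑ i, ∑ j, H i j * z j ^ 2 = 0 := by
      rw [Finset.sum_comm, ← e1]
      exact Finset.sum_congr rfl fun i _ => Finset.sum_congr rfl fun j _ => by
        rw [hsymm.apply]
    calc _ = ∑ i, ∑ j, (H i j * z i ^ 2 + H i j * z j ^ 2 + -2 * (z i * H i j * z j)) :=
          Finset.sum_congr rfl fun i _ => Finset.sum_congr rfl fun j _ => by ring
      _ = _ := by
        simp only [Finset.sum_add_distrib, ← Finset.mul_sum, e1, e2]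
        ring
  have hterm : ∀ (z : Fin n → ℝ) i j, 0 ≤ H i j * (z i - z j) ^ 2 := fun z i j => by
    rcases eq_or_ne i j with rfl | hij
    · simp
    · exact mul_nonneg (hoff i j hij) (sq_nonneg _)
  have hneg : ∀ z : Fin n → ℝ, ∑ i, z i = 0 → z ≠ 0 → ∑ i, ∑ j, z i * H i j * z j < 0 := by
    intro z hz hz0
    by_contra! hcon
    have h0 : ∑ i, ∑ j, H i j * (z i - z j) ^ 2 = 0 :=
      le_antisymm (by rw [hform]; linarith)
        (Finset.sum_nonneg fun i _ => Finset.sum_nonneg fun j _ => hterm z i j)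
    -- Every term of a vanishing Dirichlet form vanishes. Summing over `j` gives `H z = 0`, so `z`
    -- is constant, and its zero mean forces `z = 0`.
    have h1 : ∀ i j, H i j * (z i - z j) = 0 := fun i j => by
      have h2 := (Finset.sum_eq_zero_iff_of_nonneg fun i _ =>
        Finset.sum_nonneg fun j _ => hterm z i j).1 h0 i (Finset.mem_univ _)
      have h3 := (Finset.sum_eq_zero_iff_of_nonneg fun j _ => hterm z i j).1 h2 j
        (Finset.mem_univ _)
      rcases mul_eq_zero.1 h3 with h | h
      · simp [h]
      · simp [pow_eq_zero_iff two_ne_zero |>.1 h]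
    obtain ⟨c, rfl⟩ := hker z (by
      ext i
      have : ∑ j, H i j * (z i - z j) = 0 := Finset.sum_eq_zero fun j _ => h1 i j
      simp only [mul_sub, Finset.sum_sub_distrib, ← Finset.sum_mul, hrow] at this
      simp only [Matrix.mulVec, dotProduct, Pi.zero_apply]
      linarith)
    refine hz0 (funext fun i => ?_)
    have hn : (n : ℝ) ≠ 0 := by
      have := i.pos
      positivity
    simpa [hn] using hz
  -- The constant `r` is minus the maximum of the form on the unit sphere of mean-zero vectors, a
  -- compact set; homogeneity extends the bound.
  let K : Set (Fin n → ℝ) := {z | ∑ i, z i = 0 ∧ ∑ i, z i ^ 2 = 1}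
  have hK : IsCompact K := by
    refine Metric.isCompact_of_isClosed_isBounded ?_ ?_
    · exact (isClosed_eq (by fun_prop) continuous_const).inter
        (isClosed_eq (by fun_prop) continuous_const)
    · refine Metric.isBounded_closedBall (x := (0 : Fin n → ℝ)) (r := 1) |>.subset fun z hz => ?_
      rw [mem_closedBall_zero_iff, pi_norm_le_iff_of_nonneg zero_le_one]
      intro i
      have : z i ^ 2 ≤ 1 := hz.2 ▸ Finset.single_le_sum (f := fun i => z i ^ 2)
        (fun j _ => sq_nonneg (z j)) (Finset.mem_univ i)
      simpa using (sq_le_one_iff_abs_le_one _).1 this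
  have hscale : ∀ r : ℝ, (∀ z ∈ K, ∑ i, ∑ j, z i * H i j * z j ≤ -r) → ∀ z : Fin n → ℝ,
      ∑ i, z i = 0 → ∑ i, ∑ j, z i * H i j * z j ≤ -r * ∑ i, z i ^ 2 := by
    intro r hr z hz
    rcases (Finset.sum_nonneg fun i _ => sq_nonneg (z i) :
      0 ≤ ∑ i, z i ^ 2).eq_or_lt with h0 | hpos
    · have : ∀ i, z i = 0 := fun i => by
        have := (Finset.sum_eq_zero_iff_of_nonneg fun i _ => sq_nonneg (z i)).1 h0.symm i
          (Finset.mem_univ _)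
        exact pow_eq_zero_iff two_ne_zero |>.1 this
      simp [this]
    · set s := ∑ i, z i ^ 2 with hs
      have hsq : (Real.sqrt s)⁻¹ * (Real.sqrt s)⁻¹ = s⁻¹ := by
        rw [← mul_inv, Real.mul_self_sqrt hpos.le]
      have := hr (fun i => (Real.sqrt s)⁻¹ * z i) ⟨by rw [← Finset.mul_sum, hz, mul_zero], by
        simp only [mul_pow, ← Finset.mul_sum, ← hs]
        rw [sq, hsq, inv_mul_cancel₀ hpos.ne']⟩
      have e : ∑ i, ∑ j, (Real.sqrt s)⁻¹ * z i * H i j * ((Real.sqrt s)⁻¹ * z j)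
          = s⁻¹ * ∑ i, ∑ j, z i * H i j * z j := by
        simp only [Finset.mul_sum, ← hsq]
        exact Finset.sum_congr rfl fun i _ => Finset.sum_congr rfl fun j _ => by ring
      rw [e] at this
      rwa [inv_mul_le_iff₀ hpos, mul_comm s] at this
  -- The sphere is empty when `n ≤ 1`; any `r` then works.
  rcases K.eq_empty_or_nonempty with hempty | hne
  · exact ⟨1, one_pos, hscale 1 fun z hz => by simp [hempty] at hz⟩
  · obtain ⟨z, hzK, hz⟩ := hK.exists_isMaxOn hne
      (f := fun z : Fin n → ℝ => ∑ i, ∑ j, z i * H i j * z j) (by fun_prop)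
    refine ⟨-∑ i, ∑ j, z i * H i j * z j, neg_pos.2 (hneg z hzK.1 ?_), hscale _ fun y hy => ?_⟩
    · rintro rfl
      simpa using hzK.2
    · rw [neg_neg]; exact hz hy

/-! ### Frobenius estimates for centered matrices. -/

namespace Matrix

variable {n M : ℕ}

/-- The mean of each column of a matrix. -/
noncomputable def colMean (Z : Matrix (Fin n) (Fin M) ℝ) (m : Fin M) : ℝ :=
  (1 / (n : ℝ)) * ∑ i, Z i m

/-- The matrix whose columns are recentered at mean zero. -/
noncomputable def centered (Z : Matrix (Fin n) (Fin M) ℝ) : Matrix (Fin n) (Fin M) ℝ :=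
  Matrix.of fun i m => Z i m - Z.colMean m

/-- The square of the Frobenius norm. -/
noncomputable def sqNorm {k l : ℕ} (Z : Matrix (Fin k) (Fin l) ℝ) : ℝ :=
  ∑ i, ∑ m, Z i m ^ 2

theorem sqNorm_nonneg {k l : ℕ} (Z : Matrix (Fin k) (Fin l) ℝ) : 0 ≤ Z.sqNorm :=
  Finset.sum_nonneg fun _ _ => Finset.sum_nonneg fun _ _ => sq_nonneg _

theorem sq_le_sqNorm {k l : ℕ} (Z : Matrix (Fin k) (Fin l) ℝ) (i : Fin k) (m : Fin l) :
    Z i m ^ 2 ≤ Z.sqNorm :=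
  (Finset.single_le_sum (f := fun m => Z i m ^ 2) (fun _ _ => sq_nonneg _)
      (Finset.mem_univ m)).trans
    (Finset.single_le_sum (f := fun i => ∑ m, Z i m ^ 2)
      (fun _ _ => Finset.sum_nonneg fun _ _ => sq_nonneg _) (Finset.mem_univ i))

theorem sum_centered (Z : Matrix (Fin n) (Fin M) ℝ) (m : Fin M) : ∑ i, Z.centered i m = 0 := by
  rcases Nat.eq_zero_or_pos n with rfl | hn
  · simp
  · have : (n : ℝ) ≠ 0 := by positivity
    simp only [centered, colMean, of_apply, Finset.sum_sub_distrib, Finset.sum_const,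
      Finset.card_univ, Fintype.card_fin, nsmul_eq_mul]
    field_simp
    ring

theorem colMean_add_smul (Q D : Matrix (Fin n) (Fin M) ℝ) (s : ℝ) (m : Fin M) :
    (Q + s • D).colMean m = Q.colMean m + s * D.colMean m := by
  simp only [colMean, add_apply, smul_apply, smul_eq_mul, Finset.sum_add_distrib,
    ← Finset.mul_sum]
  ring

/-- Centering is an orthogonal projection: the cross term does not see the mean of `D`, and the
quadratic term only decreases when `D` is centered. -/
theorem sum_sq_centered_add_smul_le (Q D : Matrix (Fin n) (Fin M) ℝ) (s : ℝ) (m : Fin M) :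
    ∑ i, (Q + s • D).centered i m ^ 2 ≤ ∑ i, Q.centered i m ^ 2
      + 2 * s * ∑ i, Q.centered i m * D i m + s ^ 2 * ∑ i, D i m ^ 2 := by
  have e : ∀ i, (Q + s • D).centered i m ^ 2 = Q.centered i m ^ 2
      + 2 * s * (Q.centered i m * D i m) - 2 * s * D.colMean m * Q.centered i m
      + s ^ 2 * (D i m ^ 2 - D.colMean m ^ 2 - 2 * D.colMean m * D.centered i m) := fun i => by
    simp only [centered, of_apply, colMean_add_smul, add_apply, smul_apply, smul_eq_mul]
    ring
  simp only [e, Finset.sum_add_distrib, Finset.sum_sub_distrib, ← Finset.mul_sum, sum_centered,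
    Finset.sum_const]
  have : 0 ≤ s ^ 2 * ((Finset.univ : Finset (Fin n)).card • D.colMean m ^ 2) := by positivity
  linarith

theorem sqNorm_centered_add_smul_le (Q D : Matrix (Fin n) (Fin M) ℝ) (s : ℝ) :
    (Q + s • D).centered.sqNorm ≤ Q.centered.sqNorm
      + 2 * s * ∑ i, ∑ m, Q.centered i m * D i m + s ^ 2 * D.sqNorm := by
  have h := Finset.sum_le_sum fun m (_ : m ∈ Finset.univ) => sum_sq_centered_add_smul_le Q D s m
  simp only [Finset.sum_add_distrib, ← Finset.mul_sum] at h
  simp only [sqNorm]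
  rwa [Finset.sum_comm, Finset.sum_comm (f := fun i m => Q.centered i m ^ 2),
    Finset.sum_comm (f := fun i m => Q.centered i m * D i m),
    Finset.sum_comm (f := fun i m => D i m ^ 2)]

theorem sqNorm_le_of_abs_colMean_le_one {Q : Matrix (Fin n) (Fin M) ℝ}
    (h : ∀ m, |Q.colMean m| ≤ 1) : Q.sqNorm ≤ 2 * Q.centered.sqNorm + 2 * (n * M) := by
  calc Q.sqNorm ≤ ∑ i, ∑ m, (2 * Q.centered i m ^ 2 + 2) := by
        refine Finset.sum_le_sum fun i _ => Finset.sum_le_sum fun m _ => ?_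
        have h1 := (sq_le_one_iff_abs_le_one _).2 (h m)
        simp only [centered, of_apply]
        nlinarith [sq_nonneg (Q i m - 2 * Q.colMean m)]
    _ = _ := by
        simp only [sqNorm, Finset.sum_add_distrib, ← Finset.mul_sum, Finset.sum_const,
          Finset.card_univ, Fintype.card_fin, nsmul_eq_mul]
        ring

/-- Cauchy–Schwarz followed by `2√s ≤ 1 + s`, which makes the bound affine in the squared norm, as
an almost-supermartingale inequality requires. -/
theorem two_mul_sum_mul_le_frobeniusNorm {k l : ℕ} (Z c : Matrix (Fin k) (Fin l) ℝ) :
    2 * ∑ i, ∑ m, Z i m * c i m ≤ frobeniusNorm c * (1 + Z.sqNorm) := by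
  have h1 : (∑ i, ∑ m, Z i m * c i m) ≤ Real.sqrt Z.sqNorm * frobeniusNorm c := by
    have := Real.sum_mul_le_sqrt_mul_sqrt (Finset.univ : Finset (Fin k × Fin l))
      (fun x => Z x.1 x.2) (fun x => c x.1 x.2)
    simpa only [sqNorm, frobeniusNorm, Fintype.sum_prod_type] using this
  have h2 : 0 ≤ frobeniusNorm c := Real.sqrt_nonneg _
  have h3 : 2 * Real.sqrt Z.sqNorm ≤ 1 + Z.sqNorm := by
    nlinarith [Real.sq_sqrt Z.sqNorm_nonneg, sq_nonneg (Real.sqrt Z.sqNorm - 1)]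
  nlinarith

theorem two_mul_sum_mul_mul_le (Z Q : Matrix (Fin n) (Fin M) ℝ) (E : Matrix (Fin n) (Fin n) ℝ) :
    2 * ∑ i, ∑ m, Z i m * (E * Q) i m
      ≤ (∑ i, ∑ j, |E i j|) * (Z.sqNorm + Q.sqNorm) := by
  have hrow : ∀ (R : Matrix (Fin n) (Fin M) ℝ) i, ∑ m, R i m ^ 2 ≤ R.sqNorm := fun R i =>
    Finset.single_le_sum (f := fun i => ∑ m, R i m ^ 2)
      (fun _ _ => Finset.sum_nonneg fun _ _ => sq_nonneg _) (Finset.mem_univ i)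
  calc 2 * ∑ i, ∑ m, Z i m * (E * Q) i m
      = ∑ i, ∑ j, ∑ m, 2 * (Z i m * (E i j * Q j m)) := by
        simp only [Matrix.mul_apply, Finset.mul_sum]
        exact Finset.sum_congr rfl fun i _ => Finset.sum_comm
    _ ≤ ∑ i, ∑ j, ∑ m, |E i j| * (Z i m ^ 2 + Q j m ^ 2) := by
        refine Finset.sum_le_sum fun i _ => Finset.sum_le_sum fun j _ =>
          Finset.sum_le_sum fun m _ => ?_
        have h1 : 2 * (Z i m * Q j m) ≤ Z i m ^ 2 + Q j m ^ 2 := by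
          nlinarith [sq_nonneg (Z i m - Q j m)]
        have h2 : -(2 * (Z i m * Q j m)) ≤ Z i m ^ 2 + Q j m ^ 2 := by
          nlinarith [sq_nonneg (Z i m + Q j m)]
        calc 2 * (Z i m * (E i j * Q j m)) = E i j * (2 * (Z i m * Q j m)) := by ring
          _ ≤ |E i j| * |2 * (Z i m * Q j m)| := by rw [← abs_mul]; exact le_abs_self _
          _ ≤ _ := mul_le_mul_of_nonneg_left (abs_le'.2 ⟨h1, h2⟩) (abs_nonneg _)
    _ ≤ ∑ i, ∑ j, |E i j| * (Z.sqNorm + Q.sqNorm) := by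
        refine Finset.sum_le_sum fun i _ => Finset.sum_le_sum fun j _ => ?_
        rw [← Finset.mul_sum, Finset.sum_add_distrib]
        exact mul_le_mul_of_nonneg_left (add_le_add (hrow Z i) (hrow Q j)) (abs_nonneg _)
    _ = _ := by simp only [Finset.sum_mul]

/-- The drift of the recentered estimates under a perturbation of a negative definite linear
dynamics. -/
theorem two_mul_sum_centered_mul_drift_le {H : Matrix (Fin n) (Fin n) ℝ} {r : ℝ}
    (hone : H *ᵥ (fun _ => 1) = 0)
    (hr : ∀ z : Fin n → ℝ, ∑ i, z i = 0 → ∑ i, ∑ j, z i * H i j * z j ≤ -r * ∑ i, z i ^ 2)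
    (K : Matrix (Fin n) (Fin n) ℝ) (Q c : Matrix (Fin n) (Fin M) ℝ) :
    2 * ∑ i, ∑ m, Q.centered i m * ((K * Q) i m + c i m)
      ≤ -(2 * r) * Q.centered.sqNorm
        + (∑ i, ∑ j, |K i j - H i j|) * (Q.centered.sqNorm + Q.sqNorm)
        + frobeniusNorm c * (1 + Q.centered.sqNorm) := by
  have hrow : ∀ i, ∑ j, H i j = 0 := fun i => by
    simpa [Matrix.mulVec, dotProduct] using congrFun hone i
  -- Zero row sums let `H` act on the centered matrix, where its definiteness applies.
  have hH : ∀ i m, (H * Q) i m = ∑ j, H i j * Q.centered j m := fun i m => by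
    simp only [centered, of_apply, mul_sub, Finset.sum_sub_distrib, ← Finset.sum_mul, hrow,
      zero_mul, sub_zero, Matrix.mul_apply]
  have h1 : ∑ i, ∑ m, Q.centered i m * (H * Q) i m ≤ -r * Q.centered.sqNorm := by
    calc _ = ∑ m, ∑ i, ∑ j, Q.centered i m * H i j * Q.centered j m := by
          rw [Finset.sum_comm]
          simp only [hH, Finset.mul_sum, mul_assoc]
      _ ≤ ∑ m, -r * ∑ i, Q.centered i m ^ 2 :=
          Finset.sum_le_sum fun m _ => hr (fun i => Q.centered i m) (Q.sum_centered m)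
      _ = _ := by rw [← Finset.mul_sum, Finset.sum_comm]; rfl
  have h2 := two_mul_sum_mul_mul_le Q.centered Q (K - H)
  have h3 := two_mul_sum_mul_le_frobeniusNorm Q.centered c
  have e : ∑ i, ∑ m, Q.centered i m * ((K * Q) i m + c i m)
      = ∑ i, ∑ m, Q.centered i m * (H * Q) i m + ∑ i, ∑ m, Q.centered i m * ((K - H) * Q) i m
        + ∑ i, ∑ m, Q.centered i m * c i m := by
    simp only [← Finset.sum_add_distrib, Matrix.sub_mul, sub_apply]
    exact Finset.sum_congr rfl fun i _ => Finset.sum_congr rfl fun m _ => by ring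
  simp only [sub_apply] at h2
  rw [e]
  linarith

end Matrix

/-! ### Conditional expectations of bounded products. -/

section CondExp

variable {Ω : Type*} {m0 : MeasurableSpace Ω} {μ : Measure Ω}

theorem MeasureTheory.MemLp.mul_top {f g : Ω → ℝ} (hf : MemLp f ⊤ μ) (hg : MemLp g ⊤ μ) :
    MemLp (fun ω => f ω * g ω) ⊤ μ :=
  hg.mul hf

variable [IsFiniteMeasure μ]

theorem MeasureTheory.MemLp.integrable_of_top {f : Ω → ℝ} (hf : MemLp f ⊤ μ) : Integrable f μ :=
  hf.integrable le_top

theorem condExp_sum_mul {ι : Type*} [Fintype ι] {F : MeasurableSpace Ω} {z d : ι → Ω → ℝ}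
    (hz : ∀ i, StronglyMeasurable[F] (z i)) (hzb : ∀ i, MemLp (z i) ⊤ μ)
    (hd : ∀ i, MemLp (d i) ⊤ μ) :
    μ[fun ω => ∑ i, z i ω * d i ω | F] =ᵐ[μ] fun ω => ∑ i, z i ω * (μ[d i | F]) ω := by
  have h1 : μ[∑ i, z i * d i | F] =ᵐ[μ] ∑ i, μ[z i * d i | F] :=
    condExp_finsetSum (fun i _ => ((hzb i).mul_top (hd i)).integrable_of_top) F
  have h2 : ∀ i, μ[z i * d i | F] =ᵐ[μ] z i * μ[d i | F] := fun i =>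
    condExp_mul_of_stronglyMeasurable_left (hz i) ((hzb i).mul_top (hd i)).integrable_of_top
      (hd i).integrable_of_top
  have e : (fun ω => ∑ i, z i ω * d i ω) = ∑ i, z i * d i := by
    ext ω; simp
  rw [e]
  filter_upwards [h1, ae_all_iff.2 h2] with ω h3 h4
  rw [h3]
  simp [h4]

/-- The integrand is one summand of the increment minus the matching summand of `C(t)`. Weights and
messages may be conditionally dependent, since their covariance is left in `C(t)`. Replacing `y` by
its conditional mean `p` makes the `p` terms cancel. -/
theorem condExp_linear_drift {F : MeasurableSpace Ω} {w b a y p q : Ω → ℝ}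
    (hw : MemLp w ⊤ μ) (hb : MemLp b ⊤ μ) (ha : MemLp a ⊤ μ) (hy : MemLp y ⊤ μ)
    (hp : MemLp p ⊤ μ) (hq : MemLp q ⊤ μ) (hpm : StronglyMeasurable[F] p)
    (hqm : StronglyMeasurable[F] q) (hyp : μ[y | F] =ᵐ[μ] p) :
    μ[(μ[w | F] - μ[b | F]) * y + (q - p) * (w - b) - q * a | F] =ᵐ[μ]
      (μ[w | F] - μ[b | F] - μ[a | F]) * q := by
  have hwb : MemLp (μ[w | F] - μ[b | F]) ⊤ μ := (hw.condExp le_top).sub (hb.condExp le_top)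
  have hwbm : StronglyMeasurable[F] (μ[w | F] - μ[b | F]) :=
    stronglyMeasurable_condExp.sub stronglyMeasurable_condExp
  have i1 : Integrable ((μ[w | F] - μ[b | F]) * y) μ := (hwb.mul_top hy).integrable_of_top
  have i2 : Integrable ((q - p) * (w - b)) μ :=
    ((hq.sub hp).mul_top (hw.sub hb)).integrable_of_top
  have i3 : Integrable (q * a) μ := (hq.mul_top ha).integrable_of_top
  filter_upwards [condExp_sub (i1.add i2) i3 F, condExp_add i1 i2 F,
    condExp_mul_of_stronglyMeasurable_left hwbm i1 hy.integrable_of_top,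
    condExp_mul_of_stronglyMeasurable_left (hqm.sub hpm) i2 (hw.sub hb).integrable_of_top,
    condExp_mul_of_stronglyMeasurable_left hqm i3 ha.integrable_of_top,
    condExp_sub hw.integrable_of_top hb.integrable_of_top F, hyp] with ω h1 h2 h3 h4 h5 h6 h7
  rw [h1, Pi.sub_apply, h2, Pi.add_apply, h3, h4, h5]
  simp only [Pi.mul_apply, Pi.sub_apply, h6, h7]
  ring

end CondExp

/-! ### Measurability, boundedness and conditional drift of the protocol. -/

namespace SocialSampling

variable {n M : ℕ} {Ω : Type*} [mΩ : MeasurableSpace Ω] {μ : Measure Ω}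

/-- The increment of the estimates, so that `Q(t + 1) = Q(t) + δ(t) D(t)`. -/
def increment (S : SocialSampling n M μ) (t : ℕ) (ω : Ω) : Matrix (Fin n) (Fin M) ℝ :=
  (S.W t ω - S.B t ω) * S.Y t ω - S.A t ω * S.Q t ω

variable (S : SocialSampling n M μ)

theorem Q_succ (t : ℕ) (ω : Ω) : S.Q (t + 1) ω = S.Q t ω + S.δ t • S.increment t ω := by
  rw [S.update, increment, A, B]
  simp only [Matrix.sub_mul, Matrix.one_mul, Matrix.smul_mul, smul_sub]
  abel

theorem increment_apply (t : ℕ) (ω : Ω) (i : Fin n) (m : Fin M) :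
    S.increment t ω i m = ∑ j, (S.W t ω i j - S.B t ω i j) * S.Y t ω j m
      - ∑ j, S.A t ω i j * S.Q t ω j m := by
  simp [increment, Matrix.mul_apply]

theorem measurable_A (t : ℕ) (i j : Fin n) : Measurable fun ω => S.A t ω i j := by
  simp only [A, Matrix.diagonal_apply]
  split_ifs
  · exact S.measurable_a t i
  · exact measurable_const

theorem measurable_B (t : ℕ) (i j : Fin n) : Measurable fun ω => S.B t ω i j := by
  simp only [B, Matrix.diagonal_apply]
  split_ifs
  · exact S.measurable_b t i
  · exact measurable_const

theorem measurable_Q (t : ℕ) : ∀ i m, Measurable fun ω => S.Q t ω i m := by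
  induction t with
  | zero =>
    intro i m
    simp only [S.init]
    exact (measurable_of_finite fun x : Fin M => (Pi.single x (1 : ℝ) : Fin M → ℝ) m).comp
      (S.measurable_X i)
  | succ t ih =>
    intro i m
    simp only [Q_succ, Matrix.add_apply, Matrix.smul_apply, increment_apply, smul_eq_mul]
    refine (ih i m).add (measurable_const.mul (Measurable.sub ?_ ?_))
    · exact Finset.measurable_fun_sum _ fun j _ =>
        ((S.measurable_W t i j).sub (S.measurable_B t i j)).mul (S.measurable_Y t j m)
    · exact Finset.measurable_fun_sum _ fun j _ => (S.measurable_A t i j).mul (ih j m)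

theorem F_le (t : ℕ) : S.F t ≤ mΩ := by
  refine sup_le (iSup₂_le fun s _ => iSup₂_le fun i m => ?_)
    (MeasurableSpace.generateFrom_le ?_)
  · rw [← (inferInstance : BorelSpace ℝ).measurable_eq]
    exact (S.measurable_Q s i m).comap_le
  · rintro E ⟨s, _, i, j, rfl⟩
    exact S.measurableSet_G s i j

theorem F_mono : Monotone S.F := by
  intro t u htu
  refine sup_le_sup (iSup_mono fun s => iSup_le fun hs => le_iSup_of_le (hs.trans htu) le_rfl)
    (MeasurableSpace.generateFrom_mono ?_)
  rintro E ⟨s, hs, h⟩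
  exact ⟨s, hs.trans_le htu, h⟩

/-- The histories form a filtration. -/
def filtration : Filtration ℕ mΩ where
  seq := S.F
  mono' := S.F_mono
  le' := S.F_le

theorem measurable_F_Q (t : ℕ) (i : Fin n) (m : Fin M) :
    Measurable[S.F t] fun ω => S.Q t ω i m := by
  refine measurable_iff_comap_le.2 ?_
  rw [(inferInstance : BorelSpace ℝ).measurable_eq]
  refine le_trans ?_ le_sup_left
  exact le_iSup_of_le t (le_iSup_of_le le_rfl (le_iSup_of_le i (le_iSup_of_le m le_rfl)))

theorem stronglyMeasurable_Q (t : ℕ) (i : Fin n) (m : Fin M) :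
    StronglyMeasurable[S.F t] fun ω => S.Q t ω i m :=
  (S.measurable_F_Q t i m).stronglyMeasurable

theorem stronglyMeasurable_P (t : ℕ) (i : Fin n) (m : Fin M) :
    StronglyMeasurable[S.F t] fun ω => S.P t ω i m := by
  refine Measurable.stronglyMeasurable ?_
  have h : Measurable[S.F t] fun ω => S.Q t ω i :=
    @measurable_pi_lambda _ _ _ (S.F t) _ _ fun m => S.measurable_F_Q t i m
  exact ((measurable_pi_apply m).comp (S.measurable_rule t i)).comp h

theorem stronglyMeasurable_centered (t : ℕ) (i : Fin n) (m : Fin M) :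
    StronglyMeasurable[S.F t] fun ω => (S.Q t ω).centered i m := by
  simp only [Matrix.centered, Matrix.colMean, Matrix.of_apply]
  exact (S.stronglyMeasurable_Q t i m).sub (stronglyMeasurable_const.mul
    (Finset.stronglyMeasurable_fun_sum _ fun j _ => S.stronglyMeasurable_Q t j m))

theorem Y_eq_indicator (t : ℕ) (i : Fin n) (m : Fin M) :
    (fun ω => S.Y t ω i m) =
      Set.indicator {ω | S.Y t ω i = Pi.single m 1} (fun _ => (1 : ℝ)) := by
  ext ω
  rcases S.Y_mem t ω i with h | ⟨k, h⟩
  · have h0 : S.Y t ω i = 0 := h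
    rw [Set.indicator_of_notMem, h0, Pi.zero_apply]
    intro hm
    have := congrFun (h0.symm.trans hm) m
    simp at this
  · have h' : S.Y t ω i = Pi.single k 1 := h.symm
    rcases eq_or_ne k m with rfl | hkm
    · rw [Set.indicator_of_mem (by exact h'), h', Pi.single_eq_same]
    · rw [Set.indicator_of_notMem, h', Pi.single_eq_of_ne hkm.symm]
      intro hm
      have := congrFun (h'.symm.trans hm) m
      simp [Pi.single_eq_of_ne hkm.symm] at this

theorem condExp_Y (t : ℕ) (i : Fin n) (m : Fin M) :
    μ[fun ω => S.Y t ω i m | S.F t] =ᵐ[μ] fun ω => S.P t ω i m := by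
  rw [S.Y_eq_indicator]
  exact S.sampling t i m

theorem abs_Y_le_one (t : ℕ) (ω : Ω) (i : Fin n) (m : Fin M) : |S.Y t ω i m| ≤ 1 := by
  rw [congrFun (S.Y_eq_indicator t i m) ω, Set.indicator_apply]
  split_ifs <;> simp

theorem memLp_Y (t : ℕ) (i : Fin n) (m : Fin M) : MemLp (fun ω => S.Y t ω i m) ⊤ μ :=
  memLp_top_of_bound (S.measurable_Y t i m).aestronglyMeasurable 1
    (ae_of_all _ fun ω => S.abs_Y_le_one t ω i m)

/-- The sampling rule is only assumed measurable; its essential bound is inherited from the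
messages. -/
theorem memLp_P (t : ℕ) (i : Fin n) (m : Fin M) : MemLp (fun ω => S.P t ω i m) ⊤ μ :=
  ((S.memLp_Y t i m).condExp le_top).ae_eq (S.condExp_Y t i m)

variable {S}

theorem BoundedCoefficients.exists_abs_le (h : S.BoundedCoefficients) :
    ∃ K, 0 ≤ K ∧ ∀ t, ∀ᵐ ω ∂μ, ∀ i j,
      |S.W t ω i j| ≤ K ∧ |S.A t ω i j| ≤ K ∧ |S.B t ω i j| ≤ K := by
  obtain ⟨K, hK⟩ := h
  refine ⟨|K|, abs_nonneg K, fun t => ?_⟩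
  filter_upwards [hK t] with ω hω i j
  refine ⟨(hω.1 i j).trans (le_abs_self K), ?_, ?_⟩
  · simp only [A, Matrix.diagonal_apply]
    split_ifs
    · exact (hω.2 i).1.trans (le_abs_self K)
    · simp
  · simp only [B, Matrix.diagonal_apply]
    split_ifs
    · exact (hω.2 i).2.trans (le_abs_self K)
    · simp

theorem BoundedCoefficients.memLp_W (h : S.BoundedCoefficients) (t : ℕ) (i j : Fin n) :
    MemLp (fun ω => S.W t ω i j) ⊤ μ := by
  obtain ⟨K, _, hK⟩ := h.exists_abs_le
  exact memLp_top_of_bound (S.measurable_W t i j).aestronglyMeasurable K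
    ((hK t).mono fun ω hω => (hω i j).1)

theorem BoundedCoefficients.memLp_A (h : S.BoundedCoefficients) (t : ℕ) (i j : Fin n) :
    MemLp (fun ω => S.A t ω i j) ⊤ μ := by
  obtain ⟨K, _, hK⟩ := h.exists_abs_le
  exact memLp_top_of_bound (S.measurable_A t i j).aestronglyMeasurable K
    ((hK t).mono fun ω hω => (hω i j).2.1)

theorem BoundedCoefficients.memLp_B (h : S.BoundedCoefficients) (t : ℕ) (i j : Fin n) :
    MemLp (fun ω => S.B t ω i j) ⊤ μ := by
  obtain ⟨K, _, hK⟩ := h.exists_abs_le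
  exact memLp_top_of_bound (S.measurable_B t i j).aestronglyMeasurable K
    ((hK t).mono fun ω hω => (hω i j).2.2)

theorem BoundedCoefficients.memLp_increment_of_memLp_Q (h : S.BoundedCoefficients) {t : ℕ}
    (hQ : ∀ i m, MemLp (fun ω => S.Q t ω i m) ⊤ μ) (i : Fin n) (m : Fin M) :
    MemLp (fun ω => S.increment t ω i m) ⊤ μ := by
  simp only [increment_apply]
  exact (memLp_finsetSum _ fun j _ =>
      ((h.memLp_W t i j).sub (h.memLp_B t i j)).mul_top (S.memLp_Y t j m)).sub
    (memLp_finsetSum _ fun j _ => (h.memLp_A t i j).mul_top (hQ j m))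

/-- The bound may grow with `t`: it serves integrability only. -/
theorem BoundedCoefficients.memLp_Q [IsFiniteMeasure μ] (h : S.BoundedCoefficients) (t : ℕ) :
    ∀ i m, MemLp (fun ω => S.Q t ω i m) ⊤ μ := by
  induction t with
  | zero =>
    intro i m
    refine memLp_top_of_bound (S.measurable_Q 0 i m).aestronglyMeasurable 1
      (ae_of_all _ fun ω => ?_)
    rw [S.init, Pi.single_apply]
    split_ifs <;> simp
  | succ t ih =>
    intro i m
    simp only [Q_succ, Matrix.add_apply, Matrix.smul_apply, smul_eq_mul]
    exact (ih i m).add ((h.memLp_increment_of_memLp_Q ih i m).const_mul _)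

theorem BoundedCoefficients.memLp_increment [IsFiniteMeasure μ] (h : S.BoundedCoefficients)
    (t : ℕ) (i : Fin n) (m : Fin M) : MemLp (fun ω => S.increment t ω i m) ⊤ μ :=
  h.memLp_increment_of_memLp_Q (h.memLp_Q t) i m

theorem BoundedCoefficients.memLp_centered [IsFiniteMeasure μ] (h : S.BoundedCoefficients)
    (t : ℕ) (i : Fin n) (m : Fin M) : MemLp (fun ω => (S.Q t ω).centered i m) ⊤ μ := by
  simp only [Matrix.centered, Matrix.colMean, Matrix.of_apply]
  exact (h.memLp_Q t i m).sub ((memLp_finsetSum _ fun j _ => h.memLp_Q t j m).const_mul _)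

theorem C_apply (S : SocialSampling n M μ) (t : ℕ) (ω : Ω) (i : Fin n) (m : Fin M) :
    S.C t ω i m = ∑ j, (S.W t ω i j - S.B t ω i j) * (S.P t ω j m - S.Q t ω j m)
      + ∑ j, (S.W t ω i j - S.B t ω i j - S.Wbar t ω i j + S.Bbar t ω i j) * S.Y t ω j m := by
  simp [C, Matrix.mul_apply]

theorem BoundedCoefficients.memLp_C [IsFiniteMeasure μ] (h : S.BoundedCoefficients)
    (t : ℕ) (i : Fin n) (m : Fin M) : MemLp (fun ω => S.C t ω i m) ⊤ μ := by
  simp only [C_apply]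
  refine (memLp_finsetSum _ fun j _ => ?_).add (memLp_finsetSum _ fun j _ => ?_)
  · exact ((h.memLp_W t i j).sub (h.memLp_B t i j)).mul_top
      ((S.memLp_P t j m).sub (h.memLp_Q t j m))
  · exact ((((h.memLp_W t i j).sub (h.memLp_B t i j)).sub
      ((h.memLp_W t i j).condExp le_top)).add ((h.memLp_B t i j).condExp le_top)).mul_top
      (S.memLp_Y t j m)

/-- The conditional drift of the estimates is `H̄(t) Q(t) + E[C(t) | F_t]`. -/
theorem BoundedCoefficients.condExp_increment [IsFiniteMeasure μ] (h : S.BoundedCoefficients)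
    (t : ℕ) (i : Fin n) (m : Fin M) :
    ∀ᵐ ω ∂μ, (μ[fun ω => S.increment t ω i m | S.F t]) ω =
      (S.Hbar t ω * S.Q t ω) i m + condExpMatrix μ (S.F t) (S.C t) ω i m := by
  let w : Fin n → Ω → ℝ := fun j ω => S.W t ω i j
  let b : Fin n → Ω → ℝ := fun j ω => S.B t ω i j
  let a : Fin n → Ω → ℝ := fun j ω => S.A t ω i j
  let y : Fin n → Ω → ℝ := fun j ω => S.Y t ω j m
  let p : Fin n → Ω → ℝ := fun j ω => S.P t ω j m
  let q : Fin n → Ω → ℝ := fun j ω => S.Q t ω j m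
  let T : Fin n → Ω → ℝ := fun j =>
    (μ[w j | S.F t] - μ[b j | S.F t]) * y j + (q j - p j) * (w j - b j) - q j * a j
  have hw : ∀ j, MemLp (w j) ⊤ μ := h.memLp_W t i
  have hb : ∀ j, MemLp (b j) ⊤ μ := h.memLp_B t i
  have ha : ∀ j, MemLp (a j) ⊤ μ := h.memLp_A t i
  have hq : ∀ j, MemLp (q j) ⊤ μ := fun j => h.memLp_Q t j m
  have hT : ∀ j, MemLp (T j) ⊤ μ := fun j =>
    (((((hw j).condExp le_top).sub ((hb j).condExp le_top)).mul_top (S.memLp_Y t j m)).add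
      (((hq j).sub (S.memLp_P t j m)).mul_top ((hw j).sub (hb j)))).sub ((hq j).mul_top (ha j))
  have hdrift : ∀ j, μ[T j | S.F t] =ᵐ[μ]
      (μ[w j | S.F t] - μ[b j | S.F t] - μ[a j | S.F t]) * q j := fun j =>
    condExp_linear_drift (hw j) (hb j) (ha j) (S.memLp_Y t j m) (S.memLp_P t j m) (hq j)
      (S.stronglyMeasurable_P t j m) (S.stronglyMeasurable_Q t j m) (S.condExp_Y t j m)
  have hdec : (fun ω => S.increment t ω i m) = ∑ j, T j + fun ω => S.C t ω i m := by
    ext ω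
    simp only [increment_apply, C_apply, Pi.add_apply, Finset.sum_apply,
      ← Finset.sum_add_distrib, ← Finset.sum_sub_distrib]
    refine Finset.sum_congr rfl fun j _ => ?_
    simp only [T, w, b, a, y, p, q, Wbar, Bbar, condExpMatrix, Matrix.of_apply, Pi.add_apply,
      Pi.sub_apply, Pi.mul_apply]
    ring
  have hsum : μ[∑ j, T j | S.F t] =ᵐ[μ] ∑ j, μ[T j | S.F t] :=
    condExp_finsetSum (fun j _ => (hT j).integrable_of_top) _
  have hadd : μ[∑ j, T j + fun ω => S.C t ω i m | S.F t] =ᵐ[μ] _ :=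
    condExp_add (integrable_finsetSum' _ fun j _ => (hT j).integrable_of_top)
      (h.memLp_C t i m).integrable_of_top _
  rw [hdec]
  filter_upwards [hadd, hsum, ae_all_iff.2 hdrift] with ω h1 h2 h3
  rw [h1, Pi.add_apply, h2, Finset.sum_apply, Matrix.mul_apply]
  congr 1
  exact Finset.sum_congr rfl fun j _ => h3 j

/-- The increments grow at most linearly in the estimates. -/
theorem BoundedCoefficients.exists_sqNorm_increment_le (h : S.BoundedCoefficients) :
    ∃ K, 0 ≤ K ∧ ∀ t, ∀ᵐ ω ∂μ, (S.increment t ω).sqNorm ≤ K * (1 + (S.Q t ω).sqNorm) := by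
  obtain ⟨K, hK0, hK⟩ := h.exists_abs_le
  -- There are `n * M` entries, each the square of a sum of `n` terms, hence at most `n` times the
  -- sum of their squares. Each square is at most `2 (2K)² + 2 K² ‖Q‖²`.
  refine ⟨n * M * (n * (n * (8 * K ^ 2))), by positivity, fun t => ?_⟩
  filter_upwards [hK t] with ω hω
  have hterm : ∀ i j m, ((S.W t ω i j - S.B t ω i j) * S.Y t ω j m - S.A t ω i j * S.Q t ω j m) ^ 2
      ≤ 8 * K ^ 2 * (1 + (S.Q t ω).sqNorm) := fun i j m => by
    obtain ⟨h1, h2, h3⟩ := hω i j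
    have hx : |(S.W t ω i j - S.B t ω i j) * S.Y t ω j m| ≤ 2 * K := by
      rw [abs_mul]
      have := abs_sub (S.W t ω i j) (S.B t ω i j)
      nlinarith [S.abs_Y_le_one t ω j m, abs_nonneg (S.W t ω i j - S.B t ω i j),
        abs_nonneg (S.Y t ω j m)]
    have hx2 := sq_le_sq' (abs_le.1 hx).1 (abs_le.1 hx).2
    have ha2 : S.A t ω i j ^ 2 ≤ K ^ 2 := sq_le_sq' (abs_le.1 h2).1 (abs_le.1 h2).2
    have hq := (S.Q t ω).sq_le_sqNorm j m
    have hz : (S.A t ω i j * S.Q t ω j m) ^ 2 ≤ K ^ 2 * (S.Q t ω).sqNorm := by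
      rw [mul_pow]
      exact mul_le_mul ha2 hq (sq_nonneg _) (sq_nonneg _)
    have hKQ : 0 ≤ K ^ 2 * (S.Q t ω).sqNorm := mul_nonneg (sq_nonneg _) (S.Q t ω).sqNorm_nonneg
    nlinarith [sq_nonneg ((S.W t ω i j - S.B t ω i j) * S.Y t ω j m + S.A t ω i j * S.Q t ω j m)]
  have hentry : ∀ i m, S.increment t ω i m ^ 2 ≤
      n * (n * (8 * K ^ 2 * (1 + (S.Q t ω).sqNorm))) := fun i m => by
    rw [increment_apply, ← Finset.sum_sub_distrib]
    refine (sq_sum_le_card_mul_sum_sq).trans ?_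
    rw [Finset.card_univ, Fintype.card_fin]
    refine mul_le_mul_of_nonneg_left ?_ (Nat.cast_nonneg n)
    refine (Finset.sum_le_sum fun j _ => hterm i j m).trans ?_
    simp
  refine (Finset.sum_le_sum fun i _ => Finset.sum_le_sum fun m _ => hentry i m).trans ?_
  simp only [Finset.sum_const, Finset.card_univ, Fintype.card_fin, nsmul_eq_mul]
  exact le_of_eq (by ring)

end SocialSampling

/-! ### The Lyapunov recursion. -/

namespace SocialSampling

variable {n M : ℕ} {Ω : Type*} [mΩ : MeasurableSpace Ω] {μ : Measure Ω}
  {S : SocialSampling n M μ}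

theorem abs_empirical_le_one (S : SocialSampling n M μ) (ω : Ω) (m : Fin M) :
    |S.empirical ω m| ≤ 1 := by
  have h0 : 0 ≤ ∑ i, if S.X i ω = m then (1 : ℝ) else 0 :=
    Finset.sum_nonneg fun i _ => by split_ifs <;> norm_num
  have h1 : ∑ i, (if S.X i ω = m then (1 : ℝ) else 0) ≤ n :=
    (Finset.sum_le_sum fun i _ => (by split_ifs <;> norm_num : _ ≤ (1 : ℝ))).trans (by simp)
  rw [empirical, abs_of_nonneg (by positivity), one_div_mul_eq_div]
  exact div_le_one_of_le₀ h1 (Nat.cast_nonneg n)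

theorem stronglyMeasurable_Hbar (S : SocialSampling n M μ) (t : ℕ) (i j : Fin n) :
    StronglyMeasurable[S.F t] fun ω => S.Hbar t ω i j :=
  (stronglyMeasurable_condExp.sub stronglyMeasurable_condExp).sub stronglyMeasurable_condExp

theorem integrable_Hbar (S : SocialSampling n M μ) (t : ℕ) (i j : Fin n) :
    Integrable (fun ω => S.Hbar t ω i j) μ :=
  (integrable_condExp.sub integrable_condExp).sub integrable_condExp

/-- One step of the recursion for the squared deviation of the estimates from their mean. -/
theorem condExp_sqNorm_centered_succ_le [IsFiniteMeasure μ] (hbdd : S.BoundedCoefficients)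
    {H : Matrix (Fin n) (Fin n) ℝ} {r K : ℝ} (hδ : ∀ t, 0 ≤ S.δ t)
    (hmean : S.MeanPreservation) (hK0 : 0 ≤ K)
    (hK : ∀ t, ∀ᵐ ω ∂μ, (S.increment t ω).sqNorm ≤ K * (1 + (S.Q t ω).sqNorm))
    (hone : H *ᵥ (fun _ => 1) = 0)
    (hr : ∀ z : Fin n → ℝ, ∑ i, z i = 0 → ∑ i, ∑ j, z i * H i j * z j ≤ -r * ∑ i, z i ^ 2)
    (t : ℕ) :
    ∀ᵐ ω ∂μ, (μ[fun ω => (S.Q (t + 1) ω).centered.sqNorm | S.F t]) ω ≤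
      (1 + (S.δ t * (3 * (∑ i, ∑ j, |S.Hbar t ω i j - H i j|)
          + frobeniusNorm (condExpMatrix μ (S.F t) (S.C t) ω)) + S.δ t ^ 2 * (2 * K)))
        * (S.Q t ω).centered.sqNorm
      + (S.δ t * (2 * (n * M) * (∑ i, ∑ j, |S.Hbar t ω i j - H i j|)
          + frobeniusNorm (condExpMatrix μ (S.F t) (S.C t) ω))
          + S.δ t ^ 2 * (K * (1 + 2 * (n * M))))
      - 2 * r * (S.δ t * (S.Q t ω).centered.sqNorm) := by
  have hsq : ∀ {k l : ℕ} {Z : Ω → Matrix (Fin k) (Fin l) ℝ},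
      (∀ i m, MemLp (fun ω => Z ω i m) ⊤ μ) → MemLp (fun ω => (Z ω).sqNorm) ⊤ μ := by
    intro k l Z hZ
    refine memLp_finsetSum _ fun i _ => memLp_finsetSum _ fun m _ => ?_
    simp only [sq]
    exact (hZ i m).mul_top (hZ i m)
  have hsqm : ∀ {k l : ℕ} {Z : Ω → Matrix (Fin k) (Fin l) ℝ},
      (∀ i m, StronglyMeasurable[S.F t] (fun ω => Z ω i m)) →
        StronglyMeasurable[S.F t] (fun ω => (Z ω).sqNorm) := fun hZ =>
    Finset.stronglyMeasurable_fun_sum _ fun i _ => Finset.stronglyMeasurable_fun_sum _ fun m _ =>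
      (hZ i m).pow 2
  -- `R` is the part known at time `t`, and `G` is the cross term, linear in the increment, the only
  -- part whose conditional mean must be computed.
  let R : Ω → ℝ := fun ω =>
    (S.Q t ω).centered.sqNorm + S.δ t ^ 2 * (K * (1 + (S.Q t ω).sqNorm))
  let G : Ω → ℝ := fun ω =>
    ∑ x : Fin n × Fin M, (2 * S.δ t * (S.Q t ω).centered x.1 x.2) * S.increment t ω x.1 x.2
  have hR : MemLp R ⊤ μ := (hsq (hbdd.memLp_centered t)).add
    ((((memLp_const (1 : ℝ)).add (hsq (hbdd.memLp_Q t))).const_mul K).const_mul _)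
  have hRm : StronglyMeasurable[S.F t] R := (hsqm (S.stronglyMeasurable_centered t)).add
    (((stronglyMeasurable_const.add (hsqm (S.stronglyMeasurable_Q t))).const_mul _).const_mul _)
  have hZ : ∀ x : Fin n × Fin M,
      MemLp (fun ω => 2 * S.δ t * (S.Q t ω).centered x.1 x.2) ⊤ μ := fun x =>
    (hbdd.memLp_centered t x.1 x.2).const_mul _
  have hG : MemLp G ⊤ μ := memLp_finsetSum _ fun x _ =>
    (hZ x).mul_top (hbdd.memLp_increment t x.1 x.2)
  have hle : ∀ᵐ ω ∂μ, (S.Q (t + 1) ω).centered.sqNorm ≤ (R + G) ω := by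
    filter_upwards [hK t] with ω hω
    have h1 := Matrix.sqNorm_centered_add_smul_le (S.Q t ω) (S.increment t ω) (S.δ t)
    have h2 := mul_le_mul_of_nonneg_left hω (sq_nonneg (S.δ t))
    have h3 : G ω = 2 * S.δ t * ∑ i, ∑ m, (S.Q t ω).centered i m * S.increment t ω i m := by
      simp only [G, Fintype.sum_prod_type, Finset.mul_sum, mul_assoc]
    rw [Q_succ, Pi.add_apply, h3]
    linarith
  have hmono := condExp_mono (m := S.F t) (hsq (hbdd.memLp_centered (t + 1))).integrable_of_top
    (hR.add hG).integrable_of_top hle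
  have hGc := condExp_sum_mul (F := S.F t)
    (fun x : Fin n × Fin M => (S.stronglyMeasurable_centered t x.1 x.2).const_mul (2 * S.δ t))
    hZ (fun x => hbdd.memLp_increment t x.1 x.2)
  have hRc : μ[R | S.F t] = R :=
    condExp_of_stronglyMeasurable (S.F_le t) hRm hR.integrable_of_top
  have hinc := ae_all_iff.2 fun i => ae_all_iff.2 fun m => hbdd.condExp_increment t i m
  filter_upwards [hmono, condExp_add hR.integrable_of_top hG.integrable_of_top (S.F t), hGc, hinc,
    hmean t] with ω h1 h2 h3 h4 h5
  refine h1.trans ?_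
  rw [h2, Pi.add_apply, hRc, h3]
  simp only [h4, Fintype.sum_prod_type, mul_assoc, ← Finset.mul_sum]
  set Z := (S.Q t ω).centered with hZdef
  set c := condExpMatrix μ (S.F t) (S.C t) ω
  have h6 := Matrix.two_mul_sum_centered_mul_drift_le hone hr (S.Hbar t ω) (S.Q t ω) c
  set e := ∑ i, ∑ j, |S.Hbar t ω i j - H i j|
  have he : 0 ≤ e := Finset.sum_nonneg fun _ _ => Finset.sum_nonneg fun _ _ => abs_nonneg _
  -- Mean preservation enters here: column means lie in `[-1, 1]`, so the full norm is bounded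
  -- through the centered one.
  have h7 : (S.Q t ω).sqNorm ≤ 2 * Z.sqNorm + 2 * (n * M) :=
    Matrix.sqNorm_le_of_abs_colMean_le_one fun m => by
      rw [Matrix.colMean, h5 m]
      exact S.abs_empirical_le_one ω m
  have h8 := mul_le_mul_of_nonneg_left h7 he
  have h9 : 2 * ∑ i, ∑ m, Z i m * ((S.Hbar t ω * S.Q t ω) i m + c i m) ≤
      -(2 * r) * Z.sqNorm + e * (3 * Z.sqNorm + 2 * (n * M))
        + frobeniusNorm c * (1 + Z.sqNorm) := by
    rw [← hZdef] at h6
    linarith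
  have h10 := mul_le_mul_of_nonneg_left h9 (hδ t)
  have h11 := mul_le_mul_of_nonneg_left h7 (mul_nonneg (sq_nonneg (S.δ t)) hK0)
  simp only [R]
  linarith

/-- The limit of the mean dynamics has nonnegative off-diagonal entries. -/
theorem offDiag_nonneg_of_isBigO [IsProbabilityMeasure μ] {H : Matrix (Fin n) (Fin n) ℝ}
    (hδ : Tendsto S.δ atTop (𝓝 0))
    (hH : ∀ i j, ∀ᵐ ω ∂μ, (fun t => S.Hbar t ω i j - H i j) =O[atTop] S.δ)
    {i j : Fin n} (hij : i ≠ j) : 0 ≤ H i j := by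
  have h1 : ∀ t, ∀ᵐ ω ∂μ, 0 ≤ S.Hbar t ω i j := fun t => by
    have hA : (fun ω => S.A t ω i j) = 0 := by ext ω; simp [A, Matrix.diagonal_apply_ne _ hij]
    have hB : (fun ω => S.B t ω i j) = 0 := by ext ω; simp [B, Matrix.diagonal_apply_ne _ hij]
    filter_upwards [condExp_nonneg (m := S.F t) (μ := μ)
      (ae_of_all _ fun ω => S.W_nonneg t ω i j)] with ω hω
    simpa [Hbar, Wbar, Abar, Bbar, condExpMatrix, hA, hB] using hω
  -- As `H` is deterministic, a single good `ω` suffices.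
  obtain ⟨ω, hω, hO⟩ := ((ae_all_iff.2 h1).and (hH i j)).exists
  have h2 : Tendsto (fun t => S.Hbar t ω i j) atTop (𝓝 (H i j)) := by
    simpa using (hO.trans_tendsto hδ).add_const (H i j)
  exact ge_of_tendsto' h2 hω

end SocialSampling

/-! ### Almost sure convergence. -/

theorem mainTheorem3 {n M : ℕ} {Ω : Type*} [MeasurableSpace Ω] (μ : Measure Ω)
    [IsProbabilityMeasure μ] (S : SocialSampling n M μ)
    (hbounded : S.BoundedCoefficients)
    (hmixing : S.MixingCoefficients)
    (hstep : S.DecreasingStepSize)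
    (hlimit : S.LimitingDynamics)
    (hperturb : S.BoundedPerturbation)
    (hmean : S.MeanPreservation) :
    ∀ᵐ ω ∂μ, Tendsto (fun t => S.Q t ω) atTop
      (𝓝 (Matrix.of fun (_ : Fin n) => S.empirical ω)) := by
  obtain ⟨hδ0, hδlim, hδdiv, hδsq⟩ := hstep
  obtain ⟨H, hsymm, hH, -, hone, hker⟩ := hlimit
  obtain ⟨r, hr0, hr⟩ := exists_quadratic_form_le_of_offDiag_nonneg hsymm
    (fun i j hij => SocialSampling.offDiag_nonneg_of_isBigO hδlim hH hij) hone hker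
  obtain ⟨K, hK0, hK⟩ := hbounded.exists_sqNorm_increment_le
  have hsq : Summable fun t => S.δ t ^ 2 := (summable_nat_add_iff 1).1 hδsq
  have hdiv : ¬ Summable S.δ := fun hs => by
    refine not_tendsto_atTop_of_tendsto_nhds (a := ∑' t, S.δ (t + 1)) ?_ hδdiv
    refine (((summable_nat_add_iff 1).2 hs).hasSum.tendsto_sum_nat).congr fun T => ?_
    rw [Finset.range_eq_Ico, Finset.sum_Ico_add' S.δ 0 T 1]
    rfl
  let V : ℕ → Ω → ℝ := fun t ω => (S.Q t ω).centered.sqNorm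
  let e : ℕ → Ω → ℝ := fun t ω => ∑ i, ∑ j, |S.Hbar t ω i j - H i j|
  let f : ℕ → Ω → ℝ := fun t ω => frobeniusNorm (condExpMatrix μ (S.F t) (S.C t) ω)
  have he0 : ∀ t ω, 0 ≤ e t ω := fun t ω =>
    Finset.sum_nonneg fun _ _ => Finset.sum_nonneg fun _ _ => abs_nonneg _
  have hf0 : ∀ t ω, 0 ≤ f t ω := fun t ω => Real.sqrt_nonneg _
  have hV0 : ∀ t ω, 0 ≤ V t ω := fun t ω => Matrix.sqNorm_nonneg _
  have hVm : ∀ t, StronglyMeasurable[S.F t] (V t) := fun t =>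
    Finset.stronglyMeasurable_fun_sum _ fun i _ => Finset.stronglyMeasurable_fun_sum _ fun m _ =>
      (S.stronglyMeasurable_centered t i m).pow 2
  have hem : ∀ t, StronglyMeasurable[S.F t] (e t) := fun t =>
    Finset.stronglyMeasurable_fun_sum _ fun i _ => Finset.stronglyMeasurable_fun_sum _ fun j _ =>
      ((S.stronglyMeasurable_Hbar t i j).sub stronglyMeasurable_const).norm
  have hfm : ∀ t, StronglyMeasurable[S.F t] (f t) := fun t =>
    Real.continuous_sqrt.comp_stronglyMeasurable <|
      Finset.stronglyMeasurable_fun_sum _ fun i _ => Finset.stronglyMeasurable_fun_sum _ fun m _ =>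
        stronglyMeasurable_condExp.pow 2
  have hVi : ∀ t, Integrable (V t) μ := fun t =>
    integrable_finsetSum _ fun i _ => integrable_finsetSum _ fun m _ => by
      simp only [sq]
      exact ((hbounded.memLp_centered t i m).mul_top
        (hbounded.memLp_centered t i m)).integrable_of_top
  have hei : ∀ t, Integrable (e t) μ := fun t =>
    integrable_finsetSum _ fun i _ => integrable_finsetSum _ fun j _ =>
      ((S.integrable_Hbar t i j).sub (integrable_const _)).norm
  have hfi : ∀ t, Integrable (f t) μ := fun t => by
    have hs : Integrable (fun ω => 1 + f t ω ^ 2) μ := by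
      refine (integrable_const 1).add ?_
      have : ∀ ω, f t ω ^ 2 = ∑ i, ∑ m, condExpMatrix μ (S.F t) (S.C t) ω i m ^ 2 := fun ω =>
        Real.sq_sqrt (Finset.sum_nonneg fun _ _ => Finset.sum_nonneg fun _ _ => sq_nonneg _)
      simp only [this, sq]
      exact integrable_finsetSum _ fun i _ => integrable_finsetSum _ fun m _ =>
        (((hbounded.memLp_C t i m).condExp le_top).mul_top
          ((hbounded.memLp_C t i m).condExp le_top)).integrable_of_top
    refine hs.mono ((hfm t).mono (S.F_le t)).aestronglyMeasurable (ae_of_all _ fun ω => ?_)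
    rw [Real.norm_of_nonneg (hf0 t ω), Real.norm_of_nonneg (by positivity)]
    nlinarith [sq_nonneg (f t ω - 1)]
  have key := robbins_siegmund (μ := μ) (ℱ := S.filtration) (V := V)
    (α := fun t ω => S.δ t * (3 * e t ω + f t ω) + S.δ t ^ 2 * (2 * K))
    (β := fun t ω => S.δ t * (2 * (n * M) * e t ω + f t ω)
      + S.δ t ^ 2 * (K * (1 + 2 * (n * M))))
    (γ := fun t ω => 2 * r * (S.δ t * V t ω))
    hVm
    (fun t => ((((hem t).const_mul 3).add (hfm t)).const_mul _).add stronglyMeasurable_const)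
    (fun t => ((((hem t).const_mul _).add (hfm t)).const_mul _).add stronglyMeasurable_const)
    (fun t => ((hVm t).const_mul _).const_mul _)
    hVi
    (fun t => ((((hei t).const_mul _).add (hfi t)).const_mul _).add (integrable_const _))
    (fun t => ((hVi t).const_mul _).const_mul _)
    hV0
    (fun t ω => by have := he0 t ω; have := hf0 t ω; have := hδ0 t; positivity)
    (fun t ω => by have := he0 t ω; have := hf0 t ω; have := hδ0 t; positivity)
    (fun t ω => by have := hV0 t ω; have := hδ0 t; positivity)
    (fun t => SocialSampling.condExp_sqNorm_centered_succ_le hbounded hδ0 hmean hK0 hK hone hr t)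
  filter_upwards [key, ae_all_iff.2 fun i => ae_all_iff.2 fun j => hH i j, hperturb,
    ae_all_iff.2 hmean] with ω hω hHω hCω hmω
  -- The `O(δ)` constants depend on `ω`, so `α` and `β` are summable only pathwise, which is all
  -- that `robbins_siegmund` asks.
  have hmul : ∀ {g : ℕ → ℝ}, g =O[atTop] S.δ → Summable fun t => S.δ t * g t := fun hg =>
    summable_of_isBigO_nat hsq <| by
      simpa only [sq] using (isBigO_refl S.δ atTop).mul hg
  have he : (fun t => e t ω) =O[atTop] S.δ :=
    IsBigO.fun_sum fun i _ => IsBigO.fun_sum fun j _ => (hHω i j).norm_left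
  obtain ⟨⟨l, hl⟩, hγ⟩ := hω
    ((hmul ((he.const_mul_left 3).add hCω)).add (hsq.mul_right _))
    ((hmul ((he.const_mul_left _).add hCω)).add (hsq.mul_right _))
  have hδV : Summable fun t => S.δ t * V t ω :=
    (summable_mul_left_iff (by positivity : 2 * r ≠ 0)).1 hγ
  have hV := tendsto_zero_of_summable_mul hδ0 (fun t => hV0 t ω) hdiv hδV hl
  refine tendsto_pi_nhds.2 fun i => tendsto_pi_nhds.2 fun m => ?_
  have h1 : Tendsto (fun t => (S.Q t ω).centered i m ^ 2) atTop (𝓝 0) :=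
    squeeze_zero (fun _ => sq_nonneg _) (fun t => Matrix.sq_le_sqNorm _ i m) hV
  have h2 : Tendsto (fun t => (S.Q t ω).centered i m) atTop (𝓝 0) := by
    have := h1.sqrt
    simp only [Real.sqrt_sq_eq_abs, Real.sqrt_zero] at this
    exact (tendsto_zero_iff_abs_tendsto_zero _).2 this
  have h3 := h2.add_const (S.empirical ω m)
  rw [zero_add] at h3
  refine h3.congr fun t => ?_
  -- By mean preservation the subtracted column mean is the empirical distribution at every time.
  rw [← hmω t m]
  simp [Matrix.centered, Matrix.colMean]
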